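/- **Theorem 2.2.** For $i=1,2$ let $W_i\subseteq\mathbb C$ be a region (a nonempty connected open set) and let $J_i\subseteq\partial W_i$ be a simple analytic arc, i.e. $J_i=\gamma_i((a_i,b_i))$, where $\gamma_i:(a_i,b_i)\to\mathbb C$ is a homeomorphism onto its image, is given by a convergent power series near every point of $(a_i,b_i)$, and satisfies $\gamma_i'\neq 0$. Assume that $J_i$ has an open neighbourhood $U_i$ such that $U_i\cap W_i$ is a region, and that: 1. every point of $J_i$ has a neighbourhood $V$ with $V\cap\partial W_i=V\cap J_i$; 2. for every $z\in J_i$ and every disk $D(z,\varepsilon)$ with $D(z,\varepsilon)\cap\partial W_i=D(z,\varepsilon)\cap J_i$, the arc $J_i$ separates $D(z,\varepsilon)$ into two parts, one inside and one outside $W_i$: $D(z,\varepsilon)\setminus J_i=A\cup B$ with $A,B$ nonempty and open, $A\subseteq W_i$ and $B\cap W_i=\emptyset$. Let $\varphi:W_1\cup J_1\to\mathbb C$ be injective and continuous, and holomorphic on $W_1$, and suppose that $\varphi'$ extends continuously to $W_1\cup J_1$; the extension is also denoted $\varphi'$. Let $F:W_2\cup J_2\to\mathbb C$ be continuous, and holomorphic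 on $W_2$. Suppose that: - $F(J_2)\subseteq\varphi(J_1)$; - for every $z\in\varphi(J_1)$ there is $\varepsilon>0$ with $D(z,\varepsilon)\cap F(W_2)\subseteq\varphi(W_1)$; - whenever $(z_n)$ is a bounded sequence in $W_2$ all of whose accumulation points lie in $J_2$, all accumulation points of $(F(z_n))$ lie in $\varphi(J_1)$; - $F$ and $\varphi$ approach $\varphi(J_1)$ from the same side: if $w\in J_2$, $\zeta\in J_1$ and $F(w)=\varphi(\zeta)$, then $F(V\cap W_2)\cap\varphi(N\cap W_1)\neq\emptyset$ for all neighbourhoods $V$ of $w$ and $N$ of $\zeta$. Then: (a) $F'$ extends continuously from $W_2$ to $W_2\cup J_2$. (b) If moreover $\varphi'(z)\neq 0$ for all $z\in J_1$ and $F$ is injective on $W_2$, then the continuous extension of $F'$ satisfies $F'(\zeta)\neq 0$ for all $\zeta\in J_2$. -/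

import Mathlib

open Set Filter Topology Metric

/-- A simple analytic arc: the homeomorphic image of an open interval under a map `γ` which near
each parameter is the sum of its Taylor series and has nowhere vanishing derivative. -/
def IsSimpleAnalyticArc (J : Set ℂ) : Prop :=
  ∃ (a b : ℝ) (γ : ℝ → ℂ), a < b ∧
    IsEmbedding (fun t : Ioo a b => γ t) ∧
    (∀ t ∈ Ioo a b, AnalyticAt ℝ γ t ∧ deriv γ t ≠ 0) ∧
    J = γ '' Ioo a b

/-- `W` is a region of the plane and `J` is a simple analytic arc which is a free one-sided
boundary arc of `W`. -/
structure IsOneSidedFreeArc (W J : Set ℂ) : Prop where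
  isOpen : IsOpen W
  isConnected : IsConnected W
  arc : IsSimpleAnalyticArc J
  subset_frontier : J ⊆ frontier W
  /-- Some neighbourhood of the arc meets the region in a region. -/
  collar : ∃ U : Set ℂ, IsOpen U ∧ J ⊆ U ∧ IsConnected (U ∩ W)
  /-- Near each point of the arc, the whole boundary of the region is the arc. -/
  free : ∀ z ∈ J, ∃ V ∈ 𝓝 z, V ∩ frontier W = V ∩ J
  /-- In every disk centred on the arc which meets the boundary of the region only in the arc, the
  arc separates a nonempty part inside the region from a nonempty part outside the region. -/
  separates : ∀ z ∈ J, ∀ ε > 0, ball z ε ∩ frontier W = ball z ε ∩ J →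
    ∃ A B : Set ℂ, IsOpen A ∧ IsOpen B ∧ A.Nonempty ∧ B.Nonempty ∧
      A ∪ B = ball z ε \ J ∧ A ⊆ W ∧ Disjoint B W

/-- `g` is a continuous extension to `W ∪ J` of the derivative of `f` on the open set `W`. -/
def IsDerivExtension (f g : ℂ → ℂ) (W J : Set ℂ) : Prop :=
  ContinuousOn g (W ∪ J) ∧ ∀ z ∈ W, g z = deriv f z

/-- All accumulation points in the plane of the sequence `u` belong to `S`. -/
def AccumulatesOnlyIn (u : ℕ → ℂ) (S : Set ℂ) : Prop :=
  ∀ p : ℂ, MapClusterPt p atTop u → p ∈ S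

/-- `F` on `W₂` and `φ` on `W₁` approach `φ(J₁)` from the same side: if `w ∈ J₂` and `ζ ∈ J₁` have
the same image, then the images of the parts of `W₂` near `w` and of `W₁` near `ζ` always meet. -/
def ApproachFromSameSide (φ F : ℂ → ℂ) (W₁ J₁ W₂ J₂ : Set ℂ) : Prop :=
  ∀ w ∈ J₂, ∀ ζ ∈ J₁, F w = φ ζ → ∀ V ∈ 𝓝 w, ∀ N ∈ 𝓝 ζ,
    (F '' (V ∩ W₂) ∩ φ '' (N ∩ W₁)).Nonempty

/-! The claim is local on `J₂`. Fix `w ∈ J₂` and `ζ ∈ J₁` with `F w = φ ζ`. Complexifying the arc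
parametrizations gives biholomorphic charts `Γ₁`, `Γ₂` at `ζ`, `w` that carry upper half-disks into
the regions and diameters into the arcs (`IsOneSidedFreeArc.exists_isBoundaryChart`). Near `0`, `F ∘
Γ₂` takes its values in the image of `φ ∘ Γ₁`, so `H = (φ ∘ Γ₁)⁻¹ ∘ (F ∘ Γ₂)` makes sense on a
half-disk with its diameter. It is continuous, holomorphic inside and real on the diameter. Neither
`φ` nor `F` need extend across its arc, but `H` does, by Schwarz reflection
(`exists_holomorphic_lift`). As `H` preserves the upper half-plane near `0`, `H'(0) ≠ 0`
(`deriv_ne_zero_of_mapsTo_upper`). Differentiating `F ∘ Γ₂ = φ ∘ Γ₁ ∘ H` shows that `F'` tends to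
`φ'(ζ) Γ₁'(0) H'(0) / Γ₂'(0)` at `w`, which yields both conclusions. -/

/-! ### Morera's theorem and Schwarz reflection -/

/-- A function continuous on a disk centred on the real axis and holomorphic off the real axis is
holomorphic on the disk. -/
theorem differentiableOn_ball_of_differentiableAt_off_real {f : ℂ → ℂ} {c : ℂ} {r : ℝ}
    (hc : ContinuousOn f (ball c r))
    (hd : ∀ z ∈ ball c r, z.im ≠ 0 → DifferentiableAt ℂ f z) :
    DifferentiableOn ℂ f (ball c r) := by
  have key : ∀ z w : ℂ, Complex.Rectangle z w ⊆ ball c r →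
      (0 : ℝ) ∉ Ioo (min z.im w.im) (max z.im w.im) →
      (∫ x : ℝ in z.re..w.re, f (x + z.im * Complex.I)) -
        (∫ x : ℝ in z.re..w.re, f (x + w.im * Complex.I)) +
        Complex.I • (∫ y : ℝ in z.im..w.im, f (w.re + y * Complex.I)) -
        Complex.I • (∫ y : ℝ in z.im..w.im, f (z.re + y * Complex.I)) = 0 := by
    intro z w hzw h0
    refine Complex.integral_boundary_rect_eq_zero_of_differentiable_on_off_countable f z w ∅
      countable_empty (hc.mono hzw) ?_
    rintro x ⟨⟨hx1, hx2⟩, -⟩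
    refine hd x (hzw ⟨Ioo_subset_Icc_self hx1, Ioo_subset_Icc_self hx2⟩) ?_
    rintro hx
    exact h0 (hx ▸ hx2)
  refine (Complex.IsConservativeOn.isExactOn_ball hc ?_).differentiableOn isOpen_ball
  intro z w hzw
  rw [← add_eq_zero_iff_eq_neg, Complex.wedgeIntegral_add_wedgeIntegral_eq]
  by_cases h0 : (0 : ℝ) ∈ Ioo (min z.im w.im) (max z.im w.im)
  swap
  · exact key z w hzw h0
  -- The rectangle crosses the real axis. Cut it there: neither half has real points in its
  -- interior, and the two integrals along the cut cancel.
  have h0' : (0 : ℝ) ∈ uIcc z.im w.im := Ioo_subset_Icc_self h0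
  have hint : ∀ a ∈ uIcc z.re w.re, ∀ b₁ ∈ uIcc z.im w.im, ∀ b₂ ∈ uIcc z.im w.im,
      IntervalIntegrable (fun y : ℝ => f (a + y * Complex.I)) MeasureTheory.volume b₁ b₂ := by
    intro a ha b₁ hb₁ b₂ hb₂
    refine ContinuousOn.intervalIntegrable (hc.comp (by fun_prop) ?_)
    intro y hy
    exact hzw ⟨by simpa using ha, by simpa using uIcc_subset_uIcc hb₁ hb₂ hy⟩
  have h1 := key z ⟨w.re, 0⟩
    (fun x hx => hzw ⟨hx.1, uIcc_subset_uIcc left_mem_uIcc h0' hx.2⟩) (by simpa using le_of_lt)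
  have h2 := key ⟨z.re, 0⟩ w
    (fun x hx => hzw ⟨hx.1, uIcc_subset_uIcc h0' right_mem_uIcc hx.2⟩) (by simpa using le_of_lt)
  have h3 := intervalIntegral.integral_add_adjacent_intervals
    (hint z.re left_mem_uIcc z.im left_mem_uIcc 0 h0')
    (hint z.re left_mem_uIcc 0 h0' w.im right_mem_uIcc)
  have h4 := intervalIntegral.integral_add_adjacent_intervals
    (hint w.re right_mem_uIcc z.im left_mem_uIcc 0 h0')
    (hint w.re right_mem_uIcc 0 h0' w.im right_mem_uIcc)
  rw [← h3, ← h4, ← add_zero (0 : ℂ)]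
  nth_rw 1 [← h1]
  rw [← h2]
  simp only [smul_add]
  ring

/-- **Schwarz reflection principle** for a half-disk. -/
theorem exists_differentiableOn_ball_of_real_on_real {h : ℂ → ℂ} {r : ℝ}
    (hc : ContinuousOn h (ball 0 r ∩ {z | 0 ≤ z.im}))
    (hd : ∀ z ∈ ball (0 : ℂ) r, 0 < z.im → DifferentiableAt ℂ h z)
    (hr : ∀ z ∈ ball (0 : ℂ) r, z.im = 0 → (h z).im = 0) :
    ∃ H : ℂ → ℂ, DifferentiableOn ℂ H (ball 0 r) ∧
      ∀ z ∈ ball (0 : ℂ) r, 0 ≤ z.im → H z = h z := by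
  classical
  set H : ℂ → ℂ := fun z => if 0 ≤ z.im then h z else starRingEnd ℂ (h (starRingEnd ℂ z)) with hH
  refine ⟨H, differentiableOn_ball_of_differentiableAt_off_real ?_ ?_, fun z _ hz => if_pos hz⟩
  · refine ContinuousOn.if ?_ ?_ ?_
    · rintro z ⟨hz, hz'⟩
      have hz0 : z.im = 0 := by
        have : z ∈ frontier {z : ℂ | (0 : ℝ) ≤ z.im} := hz'
        rwa [Complex.frontier_setOfPred_le_im] at this
      rw [Complex.conj_eq_iff_im.2 hz0, Complex.conj_eq_iff_im.2 (hr z hz hz0)]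
    · refine hc.mono (inter_subset_inter_right _ ?_)
      rw [(isClosed_le continuous_const Complex.continuous_im).closure_eq]
    · refine Complex.continuous_conj.comp_continuousOn
        (hc.comp Complex.continuous_conj.continuousOn ?_)
      rintro z ⟨hz, hz'⟩
      simp only [not_le, Complex.closure_setOfPred_im_lt, mem_ofPred_eq] at hz'
      exact ⟨by simpa using hz, by simpa using hz'⟩
  · intro z hz hz0
    rcases lt_or_gt_of_ne hz0 with hneg | hpos
    · have h1 : DifferentiableAt ℂ h (starRingEnd ℂ z) :=
        hd _ (by simpa using hz) (by simpa using hneg)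
      have h2 := h1.conj_conj
      rw [Complex.conj_conj] at h2
      refine h2.congr_of_eventuallyEq ?_
      filter_upwards [(isOpen_lt Complex.continuous_im continuous_const).mem_nhds hneg] with x hx
      exact if_neg (not_le.2 hx)
    · refine (hd z hz hpos).congr_of_eventuallyEq ?_
      filter_upwards [(isOpen_lt continuous_const Complex.continuous_im).mem_nhds hpos] with x hx
      exact if_pos (le_of_lt hx)

/-! ### Lifts through injective maps and derivatives at the boundary -/

/-- A continuous lift of a holomorphic function through an injective holomorphic function is
holomorphic. -/
theorem differentiableAt_of_comp_injOn {g G h : ℂ → ℂ} {U V : Set ℂ} (hU : IsOpen U)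
    (hV : IsOpen V) (hg : DifferentiableOn ℂ g U) (hinj : InjOn g U)
    (hG : DifferentiableOn ℂ G V) (hh : ContinuousOn h V) (hmaps : MapsTo h V U)
    (hcomp : ∀ v ∈ V, g (h v) = G v) {v : ℂ} (hv : v ∈ V) : DifferentiableAt ℂ h v := by
  have hreg : ∀ u ∈ V, deriv g (h u) ≠ 0 → DifferentiableAt ℂ h u := by
    intro u hu hne
    have hs : HasStrictDerivAt g (deriv g (h u)) (h u) :=
      (hg.analyticAt (hU.mem_nhds (hmaps hu))).hasStrictDerivAt
    have h1 := hs.to_localInverse hne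
    rw [hcomp u hu] at h1
    have h2 : DifferentiableAt ℂ G u := hG.differentiableAt (hV.mem_nhds hu)
    have h3 := h1.hasDerivAt.differentiableAt.comp u h2
    refine h3.congr_of_eventuallyEq ?_
    have hl := (hs.hasStrictFDerivAt_equiv hne).eventually_left_inverse
    filter_upwards [(hh.continuousAt (hV.mem_nhds hu)).eventually hl, hV.mem_nhds hu] with x hx hxV
    rw [Function.comp_apply, ← hcomp x hxV]
    exact hx.symm
  have hgA : AnalyticAt ℂ g (h v) := hg.analyticAt (hU.mem_nhds (hmaps hv))
  have hGA : AnalyticAt ℂ G v := hG.analyticAt (hV.mem_nhds hv)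
  rcases hGA.eventually_eq_or_eventually_ne (analyticAt_const (v := G v)) with hconst | hne
  · have : h =ᶠ[𝓝 v] fun _ => h v := by
      filter_upwards [hconst, hV.mem_nhds hv] with x hx hxV
      refine hinj (hmaps hxV) (hmaps hv) ?_
      rw [hcomp x hxV, hcomp v hv, hx]
    exact (differentiableAt_const _).congr_of_eventuallyEq this
  -- Critical points of `g` are isolated because `g` is not locally constant. With `G` not locally
  -- constant at `v`, `h` avoids `h v` on a punctured neighbourhood, so it is differentiable there
  -- by `hreg`, and continuity removes the singularity at `v`.
  have hd : ∀ᶠ z in 𝓝[≠] (h v), deriv g z ≠ 0 := by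
    rcases hgA.deriv.eventually_eq_zero_or_eventually_ne_zero with h0 | h0
    · exfalso
      obtain ⟨ε, hε, hball⟩ := Metric.mem_nhds_iff.1 (inter_mem h0 (hU.mem_nhds (hmaps hv)))
      have hcst : ∀ x ∈ ball (h v) ε, g x = g (h v) := fun x hx =>
        isOpen_ball.is_const_of_deriv_eq_zero (convex_ball _ _).isPreconnected
          (hg.mono fun y hy => (hball hy).2) (fun y hy => (hball hy).1) hx (mem_ball_self hε)
      have hx : h v + (ε / 2 : ℝ) ∈ ball (h v) ε := by
        simp [abs_of_pos hε, hε]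
      have := hinj (hball hx).2 (hmaps hv) (hcst _ hx)
      simp [hε.ne'] at this
    · exact h0
  have hne' : ∀ᶠ x in 𝓝[≠] v, h x ≠ h v := by
    filter_upwards [hne, mem_nhdsWithin_of_mem_nhds (hV.mem_nhds hv)] with x hx hxV hxe
    exact hx (by rw [← hcomp x hxV, ← hcomp v hv, hxe])
  have hcv : ContinuousAt h v := hh.continuousAt (hV.mem_nhds hv)
  have ht : Tendsto h (𝓝[≠] v) (𝓝[≠] (h v)) :=
    tendsto_nhdsWithin_iff.2 ⟨hcv.tendsto.mono_left nhdsWithin_le_nhds, hne'⟩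
  refine (Complex.analyticAt_of_differentiable_on_punctured_nhds_of_continuousAt ?_
    hcv).differentiableAt
  filter_upwards [ht.eventually hd, mem_nhdsWithin_of_mem_nhds (hV.mem_nhds hv)] with x hx hxV
  exact hreg x hxV hx

/-- A nonconstant holomorphic function which preserves the upper half-plane near a boundary fixed
point has nonzero derivative there. -/
theorem deriv_ne_zero_of_mapsTo_upper {H : ℂ → ℂ} (hH : AnalyticAt ℂ H 0) (h0 : H 0 = 0)
    (hup : ∀ᶠ z in 𝓝 (0 : ℂ), 0 < z.im → 0 < (H z).im) : deriv H 0 ≠ 0 := by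
  have hcont : ∀ u : ℂ, Tendsto (fun t : ℝ => (t : ℂ) * u) (𝓝[>] 0) (𝓝 0) := by
    intro u
    have : Continuous (fun t : ℝ => (t : ℂ) * u) := by fun_prop
    simpa using (this.tendsto 0).mono_left nhdsWithin_le_nhds
  have hray : ∀ u : ℂ, ∀ᶠ t : ℝ in 𝓝[>] 0, 0 < u.im → 0 < (H (t * u)).im := by
    intro u
    filter_upwards [(hcont u).eventually hup, self_mem_nhdsWithin] with t ht htpos hu
    refine ht ?_
    simpa using mul_pos (show (0 : ℝ) < t from htpos) hu
  have hnt : ¬ ∀ᶠ z in 𝓝 (0 : ℂ), H z = 0 := by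
    intro hz
    obtain ⟨t, ht1, ht2⟩ := (((hcont Complex.I).eventually hz).and (hray Complex.I)).exists
    have := ht2 (by simp)
    rw [ht1] at this
    simp at this
  obtain ⟨n, k, hk, hk0, hHk⟩ := hH.exists_eventuallyEq_pow_smul_nonzero_iff.2 hnt
  simp only [sub_zero, smul_eq_mul] at hHk
  -- If `H'(0) = 0`, then `H(z) = zⁿ k(z)` with `n ≥ 2` and `k 0 ≠ 0`. Rays of argument `β / n` in
  -- the upper half-plane then reach every `β` in `(0, 2π)`, more than a half-plane can hold.
  intro hd
  have hn2 : 2 ≤ n := by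
    rcases n with _ | _ | n
    · have := hHk.self_of_nhds
      simp [h0] at this
      exact absurd this.symm hk0
    · have h1 : HasDerivAt (fun z : ℂ => z * k z) (1 * k 0 + 0 * deriv k 0) 0 :=
        (hasDerivAt_id (0 : ℂ)).mul hk.differentiableAt.hasDerivAt
      have h2 : H =ᶠ[𝓝 0] fun z : ℂ => z * k z := by
        filter_upwards [hHk] with z hz
        simpa using hz
      have h3 := h2.deriv_eq
      rw [hd, h1.deriv] at h3
      simp only [one_mul, zero_mul, add_zero] at h3
      exact absurd h3.symm hk0
    · omega
  have hn0 : (0 : ℝ) < n := by positivity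
  have key : ∀ β : ℝ, 0 < β → β < 2 * Real.pi → 0 ≤ (Complex.exp (β * Complex.I) * k 0).im := by
    intro β hβ hβ'
    set u : ℂ := Complex.exp ((β / n : ℝ) * Complex.I) with hu
    have hun : u ^ n = Complex.exp (β * Complex.I) := by
      rw [hu, ← Complex.exp_nat_mul]
      congr 1
      have : (n : ℂ) ≠ 0 := by exact_mod_cast hn0.ne'
      push_cast
      field_simp
    have huim : 0 < u.im := by
      rw [hu, Complex.exp_ofReal_mul_I_im]
      refine Real.sin_pos_of_pos_of_lt_pi (by positivity) ?_
      rw [div_lt_iff₀ hn0]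
      have : (2 : ℝ) ≤ n := by exact_mod_cast hn2
      nlinarith [Real.pi_pos]
    have hlim : Tendsto (fun t : ℝ => (u ^ n * k (t * u)).im) (𝓝[>] 0)
        (𝓝 (Complex.exp (β * Complex.I) * k 0).im) := by
      rw [← hun]
      exact (Complex.continuous_im.tendsto _).comp
        ((hk.continuousAt.tendsto.comp (hcont u)).const_mul (u ^ n))
    refine ge_of_tendsto hlim ?_
    filter_upwards [(hcont u).eventually hHk, hray u, self_mem_nhdsWithin] with t ht1 ht2 ht3
    have h3 := ht2 huim
    have h4 : H (t * u) = ((t ^ n : ℝ) : ℂ) * (u ^ n * k (t * u)) := by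
      rw [ht1]; push_cast; ring
    rw [h4, Complex.im_ofReal_mul] at h3
    have htn : (0 : ℝ) < t ^ n := pow_pos ht3 n
    exact (pos_of_mul_pos_right h3 htn.le).le
  have hexp : ∀ β : ℝ, (Complex.exp (β * Complex.I) * k 0).im =
      Real.cos β * (k 0).im + Real.sin β * (k 0).re := by
    intro β
    rw [Complex.mul_im, Complex.exp_ofReal_mul_I_re, Complex.exp_ofReal_mul_I_im]
  have hpi := Real.pi_pos
  -- Opposite directions force equality: the pair from `π/2` kills the real part of `k 0`, then the
  -- pair from `π/4` its imaginary part.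
  have e1 := key (Real.pi / 2) (by linarith) (by linarith)
  have e2 := key (Real.pi / 2 + Real.pi) (by linarith) (by linarith)
  have e3 := key (Real.pi / 4) (by linarith) (by linarith)
  have e4 := key (Real.pi / 4 + Real.pi) (by linarith) (by linarith)
  rw [hexp] at e1 e2 e3 e4
  simp only [Real.cos_add_pi, Real.sin_add_pi, Real.cos_pi_div_two, Real.sin_pi_div_two,
    Real.cos_pi_div_four, Real.sin_pi_div_four] at e1 e2 e3 e4
  have hre : (k 0).re = 0 := by linarith
  have him : (k 0).im = 0 := by
    rw [hre] at e3 e4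
    have hs : (0 : ℝ) < √2 / 2 := by positivity
    refine le_antisymm ?_ ?_ <;> nlinarith
  exact hk0 (Complex.ext hre him)

/-! ### Straightening an analytic boundary arc -/

/-- A real-analytic curve in the plane extends to a holomorphic map of a complex neighbourhood. -/
theorem exists_analyticAt_of_real_analyticAt {γ : ℝ → ℂ} {t₀ : ℝ} (hγ : AnalyticAt ℝ γ t₀) :
    ∃ Γ : ℂ → ℂ, AnalyticAt ℂ Γ 0 ∧ (∀ᶠ x : ℝ in 𝓝 0, Γ x = γ (t₀ + x)) ∧
      deriv Γ 0 = deriv γ t₀ := by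
  obtain ⟨p, hp⟩ := hγ
  -- The same Taylor coefficients, now with a complex variable; the radius depends only on their
  -- norms.
  set q : FormalMultilinearSeries ℂ ℂ ℂ := FormalMultilinearSeries.ofScalars ℂ p.coeff with hq
  have hqp : q.radius = p.radius := by
    simp only [FormalMultilinearSeries.radius, hq,
      FormalMultilinearSeries.norm_apply_eq_norm_coef, FormalMultilinearSeries.coeff_ofScalars]
  have hqpos : 0 < q.radius := hqp ▸ hp.radius_pos
  have hΓ : HasFPowerSeriesAt q.sum q 0 := (q.hasFPowerSeriesOnBall hqpos).hasFPowerSeriesAt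
  have heq : ∀ᶠ x : ℝ in 𝓝 0, q.sum x = γ (t₀ + x) := by
    have h1 := hasFPowerSeriesAt_iff.1 hp
    have h2 := (Complex.continuous_ofReal.tendsto' (0 : ℝ) (0 : ℂ) (by simp)).eventually
      (hasFPowerSeriesAt_iff.1 hΓ)
    filter_upwards [h1, h2] with x hx1 hx2
    rw [zero_add] at hx2
    refine hx2.unique ?_
    convert hx1 using 2 with n
    simp [hq, FormalMultilinearSeries.coeff_ofScalars]
  refine ⟨q.sum, hΓ.analyticAt, heq, ?_⟩
  have h1 : HasDerivAt (fun x : ℝ => q.sum x) (deriv q.sum 0) 0 := by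
    refine HasDerivAt.comp_ofReal ?_
    simpa using hΓ.analyticAt.differentiableAt.hasDerivAt
  have h2 : HasDerivAt (fun x : ℝ => γ (t₀ + x)) (deriv γ t₀) 0 := by
    have : HasDerivAt γ (deriv γ t₀) (t₀ + 0) := by
      simpa using hp.analyticAt.differentiableAt.hasDerivAt
    simpa using this.comp_const_add t₀ 0
  exact h1.unique (h2.congr_of_eventuallyEq heq)

/-- `Γ` maps the disk of radius `r` about `0` biholomorphically into the plane, the origin to `z`,
the upper half-disk into `W`, the real diameter into `J` and the lower half-disk outside `W`. -/
structure IsBoundaryChart (Γ : ℂ → ℂ) (r : ℝ) (W J : Set ℂ) (z : ℂ) : Prop where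
  pos : 0 < r
  map_zero : Γ 0 = z
  differentiableOn : DifferentiableOn ℂ Γ (ball 0 r)
  injOn : InjOn Γ (ball 0 r)
  deriv_ne_zero : ∀ u ∈ ball (0 : ℂ) r, deriv Γ u ≠ 0
  upper : ∀ u ∈ ball (0 : ℂ) r, 0 < u.im → Γ u ∈ W
  real : ∀ u ∈ ball (0 : ℂ) r, u.im = 0 → Γ u ∈ J
  lower : ∀ u ∈ ball (0 : ℂ) r, u.im < 0 → Γ u ∉ W

/-- An analytic function with nonzero derivative is biholomorphic on small disks. -/
theorem AnalyticAt.exists_injOn_ball {Γ : ℂ → ℂ} (hΓ : AnalyticAt ℂ Γ 0)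
    (hd : deriv Γ 0 ≠ 0) :
    ∃ ρ > 0, DifferentiableOn ℂ Γ (ball 0 ρ) ∧ InjOn Γ (ball 0 ρ) ∧
      ∀ u ∈ ball (0 : ℂ) ρ, deriv Γ u ≠ 0 := by
  have hl := (hΓ.hasStrictDerivAt.hasStrictFDerivAt_equiv hd).eventually_left_inverse
  have h1 : ∀ᶠ u in 𝓝 (0 : ℂ), DifferentiableAt ℂ Γ u :=
    hΓ.eventually_analyticAt.mono fun u hu => hu.differentiableAt
  have h2 : ∀ᶠ u in 𝓝 (0 : ℂ), deriv Γ u ≠ 0 := hΓ.deriv.continuousAt.eventually_ne hd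
  obtain ⟨ρ, hρ, hball⟩ := Metric.eventually_nhds_iff_ball.1 (hl.and (h1.and h2))
  refine ⟨ρ, hρ, fun u hu => (hball u hu).2.1.differentiableWithinAt, fun u hu v hv huv => ?_,
    fun u hu => (hball u hu).2.2⟩
  rw [← (hball u hu).1, huv, (hball v hv).1]

/-- Off its frontier, the plane splits into the disjoint open sets `interior W` and `(closure W)ᶜ`,
and a preconnected set lies in one of them. -/
theorem subset_or_disjoint_of_disjoint_frontier {s W : Set ℂ} (hs : IsPreconnected s)
    (hd : Disjoint s (frontier W)) : s ⊆ W ∨ Disjoint s W := by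
  have hcover : s ⊆ interior W ∪ (closure W)ᶜ := by
    intro x hx
    by_contra hx'
    rw [mem_union, not_or, notMem_compl_iff] at hx'
    exact disjoint_left.1 hd hx ⟨hx'.2, hx'.1⟩
  refine (hs.subset_or_subset isOpen_interior isClosed_closure.isOpen_compl
    (disjoint_compl_right.mono_left (interior_subset.trans subset_closure)) hcover).imp ?_ ?_
  · exact fun h => h.trans interior_subset
  · exact fun h => (disjoint_compl_left.mono_right subset_closure).mono_left h

theorem isPreconnected_upperHalfBall (r : ℝ) :
    IsPreconnected (ball (0 : ℂ) r ∩ {u | 0 < u.im}) :=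
  ((convex_ball _ _).inter (convex_halfSpace_im_gt 0)).isPreconnected

theorem isPreconnected_lowerHalfBall (r : ℝ) :
    IsPreconnected (ball (0 : ℂ) r ∩ {u | u.im < 0}) :=
  ((convex_ball _ _).inter (convex_halfSpace_im_lt 0)).isPreconnected

theorem IsOneSidedFreeArc.disjoint {W J : Set ℂ} (h : IsOneSidedFreeArc W J) : Disjoint W J :=
  (disjoint_iff_inter_eq_empty.2 h.isOpen.inter_frontier_eq).mono_right h.subset_frontier

/-- A one-sided free analytic boundary arc can be straightened near each of its points. -/
theorem IsOneSidedFreeArc.exists_isBoundaryChart {W J : Set ℂ} (h : IsOneSidedFreeArc W J)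
    {z : ℂ} (hz : z ∈ J) : ∃ (Γ : ℂ → ℂ) (r : ℝ), IsBoundaryChart Γ r W J z := by
  obtain ⟨a, b, γ, -, hemb, han, hJ⟩ := h.arc
  obtain ⟨t₀, ht₀, rfl⟩ := hJ ▸ hz
  obtain ⟨Γ, hΓ, hΓγ, hΓd⟩ := exists_analyticAt_of_real_analyticAt (han t₀ ht₀).1
  have hΓ0 : Γ 0 = γ t₀ := by simpa using hΓγ.self_of_nhds
  have hd0 : deriv Γ 0 ≠ 0 := hΓd ▸ (han t₀ ht₀).2
  obtain ⟨ρ, hρ, hdiff, hinj, hderiv⟩ := hΓ.exists_injOn_ball hd0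
  -- a real parameter interval on which `Γ` and `γ` agree
  have hI : ∀ᶠ x : ℝ in 𝓝 0, t₀ + x ∈ Ioo a b := by
    have : Tendsto (fun x : ℝ => t₀ + x) (𝓝 0) (𝓝 t₀) := by
      simpa using (continuous_const_add t₀).tendsto 0
    exact this.eventually (Ioo_mem_nhds ht₀.1 ht₀.2)
  obtain ⟨σ, hσ, hσball⟩ := Metric.eventually_nhds_iff_ball.1 (hΓγ.and hI)
  set τ := min ρ σ with hτ
  have hτpos : 0 < τ := lt_min hρ hσ
  -- near `z`, the arc is the image of this interval
  obtain ⟨O, hO, hOsub⟩ : ∃ O ∈ 𝓝 (γ t₀), ∀ t ∈ Ioo a b, γ t ∈ O → |t - t₀| < τ := by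
    have hn : {s : Ioo a b | |(s : ℝ) - t₀| < τ} ∈ 𝓝 (⟨t₀, ht₀⟩ : Ioo a b) := by
      refine IsOpen.mem_nhds ?_ (by simpa using hτpos)
      exact isOpen_lt (by fun_prop) continuous_const
    rw [hemb.nhds_eq_comap] at hn
    obtain ⟨O, hO, hOs⟩ := hn
    exact ⟨O, hO, fun t ht htO => hOs (show (⟨t, ht⟩ : Ioo a b) ∈ _ from htO)⟩
  obtain ⟨V, hV, hVJ⟩ := h.free _ hz
  have hcont : Tendsto Γ (𝓝 0) (𝓝 (γ t₀)) := hΓ0 ▸ hΓ.continuousAt.tendsto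
  obtain ⟨s, hs, hsball⟩ := Metric.eventually_nhds_iff_ball.1
    (hcont.eventually (inter_mem hO hV))
  set r := min τ s with hr
  have hrpos : 0 < r := lt_min hτpos hs
  have hrτ : ball (0 : ℂ) r ⊆ ball 0 τ := ball_subset_ball (min_le_left _ _)
  have hrs : ball (0 : ℂ) r ⊆ ball 0 s := ball_subset_ball (min_le_right _ _)
  have hrρ : ball (0 : ℂ) r ⊆ ball 0 ρ := hrτ.trans (ball_subset_ball (min_le_left _ _))
  have hreal : ∀ x : ℝ, |x| < τ → (x : ℂ) ∈ ball (0 : ℂ) ρ ∧ Γ x = γ (t₀ + x) ∧ Γ x ∈ J := by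
    intro x hx
    have h1 := hσball x (by simpa using hx.trans_le (min_le_right _ _))
    refine ⟨by simpa using hx.trans_le (min_le_left _ _), h1.1, ?_⟩
    rw [hJ, h1.1]
    exact mem_image_of_mem _ h1.2
  have hJr : ∀ u ∈ ball (0 : ℂ) r, u.im = 0 → Γ u ∈ J := by
    intro u hu h0
    have hux : u = (u.re : ℂ) := Complex.ext rfl (by simpa using h0)
    have hu' : |u.re| < τ := by
      have := hrτ hu
      rw [hux] at this
      simpa using this
    rw [hux]
    exact (hreal _ hu').2.2
  -- The embedding hypothesis prevents distant parts of the arc from returning near `γ t₀`: the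
  -- parameter is close to `t₀`, and injectivity of `Γ` makes `u` that real parameter.
  have hJr' : ∀ u ∈ ball (0 : ℂ) r, Γ u ∈ J → u.im = 0 := by
    intro u hu huJ
    have huJ' := huJ
    rw [hJ] at huJ'
    obtain ⟨t, ht, htu⟩ := huJ'
    have h1 := hOsub t ht (htu ▸ (hsball u (hrs hu)).1)
    obtain ⟨h2, h3, -⟩ := hreal (t - t₀) h1
    have h4 : ((t - t₀ : ℝ) : ℂ) = u := hinj h2 (hrρ hu) (by rw [h3, ← htu]; congr 1; ring)
    rw [← h4, Complex.ofReal_im]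
  have hfr : ∀ u ∈ ball (0 : ℂ) r, u.im ≠ 0 → Γ u ∉ frontier W := by
    intro u hu h0 huW
    have : Γ u ∈ V ∩ J := hVJ ▸ ⟨(hsball u (hrs hu)).2, huW⟩
    exact h0 (hJr' u hu this.2)
  have hc : ContinuousOn Γ (ball 0 r) := (hdiff.mono hrρ).continuousOn
  have hU : Γ '' (ball 0 r ∩ {u | 0 < u.im}) ⊆ W ∨ Disjoint (Γ '' (ball 0 r ∩ {u | 0 < u.im})) W := by
    refine subset_or_disjoint_of_disjoint_frontier
      ((isPreconnected_upperHalfBall r).image _ (hc.mono inter_subset_left)) ?_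
    rw [disjoint_left]
    rintro _ ⟨u, ⟨hu, hu'⟩, rfl⟩
    exact hfr u hu (ne_of_gt hu')
  have hL : Γ '' (ball 0 r ∩ {u | u.im < 0}) ⊆ W ∨ Disjoint (Γ '' (ball 0 r ∩ {u | u.im < 0})) W := by
    refine subset_or_disjoint_of_disjoint_frontier
      ((isPreconnected_lowerHalfBall r).image _ (hc.mono inter_subset_left)) ?_
    rw [disjoint_left]
    rintro _ ⟨u, ⟨hu, hu'⟩, rfl⟩
    exact hfr u hu (ne_of_lt hu')
  -- both sides of the arc are seen in a small disk
  obtain ⟨⟨p, hp, hp0, hpW⟩, q, hq, hq0, hqW⟩ : (∃ p ∈ ball (0 : ℂ) r, p.im ≠ 0 ∧ Γ p ∈ W) ∧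
      ∃ p ∈ ball (0 : ℂ) r, p.im ≠ 0 ∧ Γ p ∉ W := by
    have himg : Γ '' ball 0 r ∈ 𝓝 (γ t₀) := by
      rw [← hΓ0, ← hΓ.hasStrictDerivAt.map_nhds_eq hd0]
      exact image_mem_map (ball_mem_nhds _ hrpos)
    obtain ⟨ε, hε, hεsub⟩ := Metric.mem_nhds_iff.1 (inter_mem himg hV)
    obtain ⟨A, B, -, -, ⟨x, hx⟩, ⟨y, hy⟩, hAB, hAW, hBW⟩ := h.separates _ hz ε hε (by
      ext x
      constructor
      · rintro ⟨hx1, hx2⟩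
        exact ⟨hx1, (hVJ ▸ (⟨(hεsub hx1).2, hx2⟩ : x ∈ V ∩ frontier W) : x ∈ V ∩ J).2⟩
      · rintro ⟨hx1, hx2⟩
        exact ⟨hx1, h.subset_frontier hx2⟩)
    have hx' : x ∈ ball (γ t₀) ε \ J := hAB ▸ Or.inl hx
    have hy' : y ∈ ball (γ t₀) ε \ J := hAB ▸ Or.inr hy
    obtain ⟨u, hu, rfl⟩ := (hεsub hx'.1).1
    obtain ⟨v, hv, rfl⟩ := (hεsub hy'.1).1
    exact ⟨⟨u, hu, fun h0 => hx'.2 (hJr u hu h0), hAW hx⟩,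
      ⟨v, hv, fun h0 => hy'.2 (hJr v hv h0), disjoint_left.1 hBW hy⟩⟩
  have hdr : DifferentiableOn ℂ Γ (ball 0 r) := hdiff.mono hrρ
  -- Two equal sides contradict the points `p`, `q`. If the lower half-disk is the inner one,
  -- precompose with `u ↦ -u`.
  rcases hU with hU | hU <;> rcases hL with hL | hL
  · exfalso
    rcases lt_or_gt_of_ne hq0 with h' | h'
    · exact hqW (hL (mem_image_of_mem _ ⟨hq, h'⟩))
    · exact hqW (hU (mem_image_of_mem _ ⟨hq, h'⟩))
  · exact ⟨Γ, r, hrpos, hΓ0, hdr, hinj.mono hrρ, fun u hu => hderiv u (hrρ hu),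
      fun u hu hu' => hU (mem_image_of_mem _ ⟨hu, hu'⟩), hJr,
      fun u hu hu' => disjoint_left.1 hL (mem_image_of_mem _ ⟨hu, hu'⟩)⟩
  · have hneg : MapsTo (fun u : ℂ => -u) (ball 0 r) (ball 0 r) := fun u hu => by simpa using hu
    refine ⟨fun u => Γ (-u), r, hrpos, by simpa using hΓ0,
      hdr.comp differentiable_neg.differentiableOn hneg,
      fun u hu v hv huv => neg_injective (hinj (hrρ (hneg hu)) (hrρ (hneg hv)) huv),
      fun u hu => ?_,
      fun u hu hu' => hL (mem_image_of_mem _ ⟨hneg hu, by simpa using hu'⟩),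
      fun u hu hu' => hJr _ (hneg hu) (by simpa using hu'),
      fun u hu hu' => disjoint_left.1 hU (mem_image_of_mem _ ⟨hneg hu, by simpa using hu'⟩)⟩
    rw [deriv_comp_neg]
    exact neg_ne_zero.2 (hderiv _ (hrρ (hneg hu)))
  · exfalso
    rcases lt_or_gt_of_ne hp0 with h' | h'
    · exact disjoint_left.1 hL (mem_image_of_mem _ ⟨hp, h'⟩) hpW
    · exact disjoint_left.1 hU (mem_image_of_mem _ ⟨hp, h'⟩) hpW

/-! ### The lift on a half-disk and its reflection -/

/-- The inverse of an injective continuous map on a compact set is continuous. -/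
theorem IsCompact.continuousOn_invFunOn {X Y : Type*} [TopologicalSpace X] [TopologicalSpace Y]
    [T2Space Y] [Nonempty X] {g : X → Y} {K : Set X} (hK : IsCompact K) (hg : ContinuousOn g K)
    (hinj : InjOn g K) : ContinuousOn (Function.invFunOn g K) (g '' K) := by
  rw [continuousOn_iff_isClosed]
  intro t ht
  refine ⟨g '' (K ∩ t), ((hK.inter_right ht).image_of_continuousOn
    (hg.mono inter_subset_left)).isClosed, ?_⟩
  ext y
  constructor
  · rintro ⟨hy, hyK⟩
    exact ⟨⟨_, ⟨Function.invFunOn_mem hyK, hy⟩, Function.invFunOn_eq hyK⟩, hyK⟩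
  · rintro ⟨⟨k, ⟨hk, hkt⟩, rfl⟩, hyK⟩
    refine ⟨?_, hyK⟩
    rwa [mem_preimage, hinj.leftInvOn_invFunOn hk]

theorem isOpen_upperHalfBall (s : ℝ) : IsOpen (ball (0 : ℂ) s ∩ {u | 0 < u.im}) :=
  isOpen_ball.inter (isOpen_lt continuous_const Complex.continuous_im)

/-- An injective holomorphic function on a half-disk is open. -/
theorem isOpen_image_upperHalfBall {g : ℂ → ℂ} {s : ℝ} (hs : 0 < s)
    (hg : DifferentiableOn ℂ g (ball 0 s ∩ {u | 0 < u.im}))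
    (hinj : InjOn g (ball 0 s ∩ {u | 0 < u.im})) :
    IsOpen (g '' (ball 0 s ∩ {u | 0 < u.im})) := by
  rcases (hg.analyticOnNhd (isOpen_upperHalfBall s)).is_constant_or_isOpen
    (isPreconnected_upperHalfBall s) with ⟨c, hc⟩ | h
  · exfalso
    have hmem : ∀ t : ℝ, 0 < t → t < 1 →
        ((t * s : ℝ) : ℂ) * Complex.I ∈ ball (0 : ℂ) s ∩ {u | 0 < u.im} := by
      intro t ht ht'
      refine ⟨?_, ?_⟩
      · rw [mem_ball_zero_iff, norm_mul, Complex.norm_I, mul_one, Complex.norm_real,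
          Real.norm_of_nonneg (by positivity)]
        nlinarith
      · simpa using mul_pos ht hs
    have h1 := hmem (1 / 2) (by norm_num) (by norm_num)
    have h2 := hmem (1 / 3) (by norm_num) (by norm_num)
    have h3 := congrArg Complex.im (hinj h1 h2 ((hc _ h1).trans (hc _ h2).symm))
    simp only [Complex.im_ofReal_mul, Complex.I_im] at h3
    nlinarith
  · exact h _ subset_rfl (isOpen_upperHalfBall s)

/-- A holomorphic function `G` on a half-disk which, near `0`, approaches the image of an injective
function `g` from the side on which `g` lives, and maps the diameter into the image of the diameter,
is `g` composed with a function which is locally biholomorphic at `0`. -/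
theorem exists_holomorphic_lift {g G : ℂ → ℂ} {s r : ℝ} (hs : 0 < s) (hr : 0 < r)
    (hg : ContinuousOn g (closedBall 0 s ∩ {u | 0 ≤ u.im}))
    (hinj : InjOn g (closedBall 0 s ∩ {u | 0 ≤ u.im}))
    (hgd : DifferentiableOn ℂ g (ball 0 s ∩ {u | 0 < u.im}))
    (hG : ContinuousOn G (ball 0 r ∩ {u | 0 ≤ u.im}))
    (hGd : DifferentiableOn ℂ G (ball 0 r ∩ {u | 0 < u.im}))
    (h0 : G 0 = g 0)
    (hreal : ∀ u ∈ ball (0 : ℂ) r, u.im = 0 →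
      ∀ k ∈ closedBall (0 : ℂ) s ∩ {u | 0 ≤ u.im}, g k = G u → k.im = 0)
    (hup : ∀ u ∈ ball (0 : ℂ) r, 0 < u.im →
      ∀ k ∈ closedBall (0 : ℂ) s ∩ {u | 0 ≤ u.im}, g k = G u → k.im ≠ 0)
    (hside : ∀ V ∈ 𝓝 (0 : ℂ),
      (G '' (V ∩ {u | 0 < u.im}) ∩ g '' (ball 0 s ∩ {u | 0 < u.im})).Nonempty) :
    ∃ δ > 0, δ ≤ r ∧ ∃ H : ℂ → ℂ, DifferentiableOn ℂ H (ball 0 δ) ∧ H 0 = 0 ∧ deriv H 0 ≠ 0 ∧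
      ∀ u ∈ ball (0 : ℂ) δ, 0 < u.im → H u ∈ ball (0 : ℂ) s ∧ 0 < (H u).im ∧ g (H u) = G u := by
  set K : Set ℂ := closedBall 0 s ∩ {u | 0 ≤ u.im} with hKdef
  set U : Set ℂ := ball 0 s ∩ {u | 0 < u.im} with hUdef
  have hup_closed : IsClosed {u : ℂ | 0 ≤ u.im} :=
    isClosed_le continuous_const Complex.continuous_im
  have hK : IsCompact K := (isCompact_closedBall 0 s).inter_right hup_closed
  have hUK : U ⊆ K := fun u hu => ⟨ball_subset_closedBall hu.1, (le_of_lt hu.2 : 0 ≤ u.im)⟩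
  have h0K : (0 : ℂ) ∈ K := ⟨by simpa using hs.le, by simp⟩
  have hUopen : IsOpen (g '' U) := isOpen_image_upperHalfBall hs hgd (hinj.mono hUK)
  have hclos : closure (g '' U) ⊆ g '' K :=
    closure_minimal (image_mono hUK) (hK.image_of_continuousOn hg).isClosed
  -- near `0`, the function `G` avoids the image of the circular arc
  set T : Set ℂ := sphere 0 s ∩ {u | 0 ≤ u.im} with hTdef
  have hTK : T ⊆ K := inter_subset_inter_left _ sphere_subset_closedBall
  have hT : IsClosed (g '' T) :=
    (((isCompact_sphere 0 s).inter_right hup_closed).image_of_continuousOn (hg.mono hTK)).isClosed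
  have h0T : G 0 ∉ g '' T := by
    rw [h0]
    rintro ⟨k, hk, hk'⟩
    have : k = 0 := hinj (hTK hk) h0K hk'
    have hk1 := hk.1
    rw [this, mem_sphere_zero_iff_norm, norm_zero] at hk1
    exact hs.ne hk1
  have h0r : (0 : ℂ) ∈ ball (0 : ℂ) r ∩ {u | 0 ≤ u.im} := ⟨mem_ball_self hr, by simp⟩
  obtain ⟨δ, hδ, hδr, hδT⟩ : ∃ δ > 0, δ ≤ r ∧
      ∀ u ∈ ball (0 : ℂ) δ, 0 ≤ u.im → G u ∉ g '' T := by
    have h1 := (hG 0 h0r).eventually (hT.isOpen_compl.mem_nhds h0T)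
    obtain ⟨δ, hδ, hball⟩ := Metric.mem_nhdsWithin_iff.1 h1
    refine ⟨min δ r, lt_min hδ hr, min_le_right _ _, fun u hu hu' => ?_⟩
    exact hball ⟨ball_subset_ball (min_le_left _ _) hu, ball_subset_ball (min_le_right _ _) hu, hu'⟩
  have hδr' : ball (0 : ℂ) δ ⊆ ball 0 r := ball_subset_ball hδr
  set D : Set ℂ := ball 0 δ ∩ {u | 0 < u.im} with hDdef
  have hDr : D ⊆ ball 0 r ∩ {u | 0 ≤ u.im} := fun u hu => ⟨hδr' hu.1, (le_of_lt hu.2 : 0 ≤ u.im)⟩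
  -- A frontier point of `g '' U` comes from the diameter or from the circular arc `T`. `hup`
  -- excludes the first on `G '' D` and the choice of `δ` the second, so `G '' D` lies on one side;
  -- `hside` says which.
  have hGU : G '' D ⊆ g '' U := by
    have hfr : Disjoint (G '' D) (frontier (g '' U)) := by
      rw [disjoint_left]
      rintro _ ⟨u, hu, rfl⟩ hfr
      rw [hUopen.frontier_eq] at hfr
      obtain ⟨k, hk, hku⟩ := hclos hfr.1
      have him := hup u (hδr' hu.1) hu.2 k hk hku
      have him' : 0 < k.im := lt_of_le_of_ne hk.2 him.symm
      rcases (mem_closedBall_zero_iff.1 hk.1).lt_or_eq with hlt | heq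
      · exact hfr.2 ⟨k, ⟨mem_ball_zero_iff.2 hlt, him'⟩, hku⟩
      · exact hδT u hu.1 (le_of_lt hu.2) ⟨k, ⟨mem_sphere_zero_iff_norm.2 heq, hk.2⟩, hku⟩
    rcases subset_or_disjoint_of_disjoint_frontier
      ((isPreconnected_upperHalfBall δ).image _ (hG.mono hDr)) hfr with h | h
    · exact h
    · exact absurd (hside _ (ball_mem_nhds 0 hδ)) (not_nonempty_iff_eq_empty.2 h.inter_eq)
  have hGK : MapsTo G (ball 0 δ ∩ {u | 0 ≤ u.im}) (g '' K) := by
    intro u hu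
    have hcl : u ∈ closure D := by
      rw [Metric.mem_closure_iff]
      intro ε hε
      have hpos : 0 < δ - ‖u‖ := sub_pos.2 (mem_ball_zero_iff.1 hu.1)
      set t : ℝ := min (ε / 2) ((δ - ‖u‖) / 2) with ht
      have htpos : 0 < t := lt_min (by linarith) (by linarith)
      have ht1 : t ≤ ε / 2 := min_le_left _ _
      have ht2 : t ≤ (δ - ‖u‖) / 2 := min_le_right _ _
      have hnorm : ‖(t : ℂ) * Complex.I‖ = t := by
        rw [norm_mul, Complex.norm_I, mul_one, Complex.norm_real, Real.norm_of_nonneg htpos.le]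
      refine ⟨u + t * Complex.I, ⟨?_, ?_⟩, ?_⟩
      · rw [mem_ball_zero_iff]
        have := norm_add_le u ((t : ℂ) * Complex.I)
        linarith
      · have hu2 : 0 ≤ u.im := hu.2
        simpa using add_pos_of_nonneg_of_pos hu2 htpos
      · rw [dist_self_add_right, hnorm]
        linarith
    refine hclos ?_
    have h1 : ContinuousWithinAt G D u := (hG u ⟨hδr' hu.1, hu.2⟩).mono hDr
    exact closure_mono hGU (h1.mem_closure_image hcl)
  -- Compactness of `K` is what makes this inverse continuous up to the diameter.
  set h : ℂ → ℂ := fun u => Function.invFunOn g K (G u) with hh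
  have hhK : ∀ u ∈ ball (0 : ℂ) δ, 0 ≤ u.im → h u ∈ K ∧ g (h u) = G u := fun u hu hu' =>
    ⟨Function.invFunOn_mem (hGK ⟨hu, hu'⟩), Function.invFunOn_eq (hGK ⟨hu, hu'⟩)⟩
  have hhc : ContinuousOn h (ball 0 δ ∩ {u | 0 ≤ u.im}) :=
    (hK.continuousOn_invFunOn hg hinj).comp
      (hG.mono (inter_subset_inter_left _ hδr')) hGK
  have hhU : MapsTo h D U := by
    intro u hu
    obtain ⟨k, hk, hku⟩ := hGU (mem_image_of_mem G hu)
    have h1 := hhK u hu.1 (le_of_lt hu.2)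
    rwa [hinj h1.1 (hUK hk) (h1.2.trans hku.symm)]
  have hhd : ∀ u ∈ ball (0 : ℂ) δ, 0 < u.im → DifferentiableAt ℂ h u := fun u hu hu' =>
    differentiableAt_of_comp_injOn (isOpen_upperHalfBall s) (isOpen_upperHalfBall δ) hgd
      (hinj.mono hUK) (hGd.mono (inter_subset_inter_left _ hδr'))
      (hhc.mono fun u hu => ⟨hu.1, (le_of_lt hu.2 : 0 ≤ u.im)⟩) hhU
      (fun v hv => (hhK v hv.1 (le_of_lt hv.2)).2) ⟨hu, hu'⟩
  obtain ⟨H, hH, hHh⟩ := exists_differentiableOn_ball_of_real_on_real hhc hhd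
    (fun u hu hu' => hreal u (hδr' hu) hu' _ (hhK u hu hu'.ge).1 (hhK u hu hu'.ge).2)
  have hH0 : H 0 = 0 := by
    rw [hHh 0 (mem_ball_self hδ) (by simp)]
    have h1 := hhK 0 (mem_ball_self hδ) (by simp)
    exact hinj h1.1 h0K (h1.2.trans h0)
  have hHU : ∀ u ∈ ball (0 : ℂ) δ, 0 < u.im → H u ∈ U := fun u hu hu' => by
    rw [hHh u hu hu'.le]
    exact hhU ⟨hu, hu'⟩
  refine ⟨δ, hδ, hδr, H, hH, hH0, ?_, fun u hu hu' => ⟨(hHU u hu hu').1, (hHU u hu hu').2, ?_⟩⟩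
  · refine deriv_ne_zero_of_mapsTo_upper (hH.analyticAt (ball_mem_nhds 0 hδ)) hH0 ?_
    filter_upwards [ball_mem_nhds 0 hδ] with u hu hu'
    exact (hHU u hu hu').2
  · rw [hHh u hu hu'.le]
    exact (hhK u hu hu'.le).2

namespace IsBoundaryChart

variable {Γ : ℂ → ℂ} {r : ℝ} {W J : Set ℂ} {z : ℂ}

theorem mono (h : IsBoundaryChart Γ r W J z) {s : ℝ} (hs : 0 < s) (hsr : s ≤ r) :
    IsBoundaryChart Γ s W J z :=
  have hb := ball_subset_ball (x := (0 : ℂ)) hsr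
  ⟨hs, h.map_zero, h.differentiableOn.mono hb, h.injOn.mono hb,
    fun u hu => h.deriv_ne_zero u (hb hu), fun u hu => h.upper u (hb hu),
    fun u hu => h.real u (hb hu), fun u hu => h.lower u (hb hu)⟩

theorem analyticAt (h : IsBoundaryChart Γ r W J z) {u : ℂ} (hu : u ∈ ball (0 : ℂ) r) :
    AnalyticAt ℂ Γ u :=
  h.differentiableOn.analyticAt (isOpen_ball.mem_nhds hu)

theorem image_mem_nhds (h : IsBoundaryChart Γ r W J z) {V : Set ℂ} (hV : V ∈ 𝓝 0) :
    Γ '' V ∈ 𝓝 z := by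
  have h0 := mem_ball_self (x := (0 : ℂ)) h.pos
  rw [← h.map_zero, ← (h.analyticAt h0).hasStrictDerivAt.map_nhds_eq (h.deriv_ne_zero 0 h0)]
  exact image_mem_map hV

theorem im_pos_of_mem (h : IsBoundaryChart Γ r W J z) (hWJ : Disjoint W J) {u : ℂ}
    (hu : u ∈ ball (0 : ℂ) r) (huW : Γ u ∈ W) : 0 < u.im := by
  rcases lt_trichotomy u.im 0 with hlt | heq | hgt
  · exact absurd huW (h.lower u hu hlt)
  · exact absurd (h.real u hu heq) (disjoint_left.1 hWJ huW)
  · exact hgt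

theorem mapsTo_union (h : IsBoundaryChart Γ r W J z) :
    MapsTo Γ (ball 0 r ∩ {u | 0 ≤ u.im}) (W ∪ J) := by
  rintro u ⟨hu, hu'⟩
  rcases (show 0 ≤ u.im from hu').lt_or_eq with hlt | heq
  · exact Or.inl (h.upper u hu hlt)
  · exact Or.inr (h.real u hu heq.symm)

/-- This transfers limits: a limit at `z` along `W` may be computed in the chart, from the upper
half-plane at `0`. -/
theorem nhdsWithin_le_map (h : IsBoundaryChart Γ r W J z) (hWJ : Disjoint W J) :
    𝓝[W] z ≤ map Γ (𝓝[{u | 0 < u.im}] 0) := by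
  intro S hS
  obtain ⟨V, hV, hVS⟩ := mem_nhdsWithin_iff_exists_mem_nhds_inter.1 (mem_map.1 hS)
  refine mem_nhdsWithin_iff_exists_mem_nhds_inter.2
    ⟨_, h.image_mem_nhds (inter_mem hV (ball_mem_nhds 0 h.pos)), ?_⟩
  rintro _ ⟨⟨u, ⟨huV, hu⟩, rfl⟩, huW⟩
  exact hVS ⟨huV, h.im_pos_of_mem hWJ hu huW⟩

end IsBoundaryChart

/-! ### The limit of the derivative at an arc point -/

/-- Under the hypotheses of the reflection argument, `F'` has a limit at every point of the arc,
which does not vanish where the derivative of the parametrization `φ` does not vanish. -/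
theorem exists_tendsto_deriv {W₁ J₁ W₂ J₂ : Set ℂ}
    (h₁ : IsOneSidedFreeArc W₁ J₁) (h₂ : IsOneSidedFreeArc W₂ J₂) {φ φ' : ℂ → ℂ}
    (hφ_inj : InjOn φ (W₁ ∪ J₁)) (hφ_cont : ContinuousOn φ (W₁ ∪ J₁))
    (hφ_hol : DifferentiableOn ℂ φ W₁) (hφ' : IsDerivExtension φ φ' W₁ J₁) {F : ℂ → ℂ}
    (hF_cont : ContinuousOn F (W₂ ∪ J₂)) (hF_hol : DifferentiableOn ℂ F W₂)
    (hF_arc : F '' J₂ ⊆ φ '' J₁)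
    (hF_loc : ∀ z ∈ φ '' J₁, ∃ ε > 0, ball z ε ∩ F '' W₂ ⊆ φ '' W₁)
    (hF_side : ApproachFromSameSide φ F W₁ J₁ W₂ J₂) {w : ℂ} (hw : w ∈ J₂) :
    ∃ y, Tendsto (deriv F) (𝓝[W₂] w) (𝓝 y) ∧ ((∀ z ∈ J₁, φ' z ≠ 0) → y ≠ 0) := by
  obtain ⟨ζ, hζ, hζw⟩ := hF_arc (mem_image_of_mem F hw)
  obtain ⟨Γ₁, r₁, c₁⟩ := h₁.exists_isBoundaryChart hζ
  obtain ⟨Γ₂, r₂, c₂⟩ := h₂.exists_isBoundaryChart hw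
  obtain ⟨ε, hε, hεsub⟩ := hF_loc _ (mem_image_of_mem φ hζ)
  -- Halving the radius keeps the closed half-disk, needed for compactness, inside the chart.
  set s := r₁ / 2 with hs
  have hspos : 0 < s := half_pos c₁.pos
  have hsr : closedBall (0 : ℂ) s ⊆ ball 0 r₁ := closedBall_subset_ball (half_lt_self c₁.pos)
  have hK₁ : closedBall (0 : ℂ) s ∩ {u | 0 ≤ u.im} ⊆ ball 0 r₁ ∩ {u | 0 ≤ u.im} :=
    inter_subset_inter_left _ hsr
  have hG₂ : ContinuousOn (F ∘ Γ₂) (ball 0 r₂ ∩ {u | 0 ≤ u.im}) :=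
    hF_cont.comp (c₂.differentiableOn.continuousOn.mono inter_subset_left) c₂.mapsTo_union
  have hG0 : (F ∘ Γ₂) 0 = (φ ∘ Γ₁) 0 := by
    simp only [Function.comp_apply, c₁.map_zero, c₂.map_zero, hζw]
  obtain ⟨r, hr, hrr, hrε⟩ : ∃ r > 0, r ≤ r₂ ∧
      ∀ u ∈ ball (0 : ℂ) r, 0 ≤ u.im → F (Γ₂ u) ∈ ball (φ ζ) ε := by
    have h1 := (hG₂ 0 ⟨mem_ball_self c₂.pos, by simp⟩).eventually (ball_mem_nhds _ hε)
    obtain ⟨δ, hδ, hball⟩ := Metric.mem_nhdsWithin_iff.1 h1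
    refine ⟨min δ r₂, lt_min hδ c₂.pos, min_le_right _ _, fun u hu hu' => ?_⟩
    have h2 : (F ∘ Γ₂) u ∈ ball ((F ∘ Γ₂) 0) ε := hball ⟨ball_subset_ball (min_le_left _ _) hu,
      ball_subset_ball (min_le_right _ _) hu, hu'⟩
    rw [hG0] at h2
    simpa only [Function.comp_apply, c₁.map_zero] using h2
  replace c₂ := c₂.mono hr hrr
  have hd₁ : DifferentiableOn ℂ (φ ∘ Γ₁) (ball 0 r₁ ∩ {u | 0 < u.im}) :=
    hφ_hol.comp (c₁.differentiableOn.mono inter_subset_left) fun u hu => c₁.upper u hu.1 hu.2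
  have hd₂ : DifferentiableOn ℂ (F ∘ Γ₂) (ball 0 r ∩ {u | 0 < u.im}) :=
    hF_hol.comp (c₂.differentiableOn.mono inter_subset_left) fun u hu => c₂.upper u hu.1 hu.2
  -- Injectivity of `φ` on `W₁ ∪ J₁`, with `W₁` and `J₁` disjoint, separates the two kinds of
  -- values: those of `F` on `J₂` lift only to the diameter, and nearby values of `F` on `W₂` never
  -- lift to it, by `hF_loc`.
  obtain ⟨δ, hδ, hδr, H, hH, hH0, hH', hHU⟩ := exists_holomorphic_lift (g := φ ∘ Γ₁) (G := F ∘ Γ₂)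
    hspos hr
    (hφ_cont.comp (c₁.differentiableOn.continuousOn.mono (hK₁.trans inter_subset_left))
      (c₁.mapsTo_union.mono_left hK₁))
    (hφ_inj.comp (c₁.injOn.mono (hK₁.trans inter_subset_left)) (c₁.mapsTo_union.mono_left hK₁))
    (hd₁.mono (inter_subset_inter_left _ (ball_subset_closedBall.trans hsr)))
    (hG₂.mono (inter_subset_inter_left _ (ball_subset_ball hrr))) hd₂ hG0
    (by
      intro u hu hu0 k hk hku
      obtain ⟨x, hx, hxu⟩ := hF_arc (mem_image_of_mem F (c₂.real u hu hu0))
      have hkx : Γ₁ k = x := hφ_inj (c₁.mapsTo_union (hK₁ hk)) (Or.inr hx) (hku.trans hxu.symm)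
      by_contra hk0
      have hkW := c₁.upper k (hsr hk.1) (lt_of_le_of_ne hk.2 (Ne.symm hk0))
      exact disjoint_left.1 h₁.disjoint hkW (hkx ▸ hx))
    (by
      intro u hu hu0 k hk hku hk0
      obtain ⟨x, hx, hxu⟩ := hεsub
        ⟨hrε u hu hu0.le, mem_image_of_mem F (c₂.upper u hu hu0)⟩
      have hkx : Γ₁ k = x := hφ_inj (c₁.mapsTo_union (hK₁ hk)) (Or.inl hx) (hku.trans hxu.symm)
      exact disjoint_left.1 h₁.disjoint hx (hkx ▸ c₁.real k (hsr hk.1) hk0))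
    (by
      intro V hV
      obtain ⟨_, ⟨_, ⟨⟨u, ⟨huV, hu⟩, rfl⟩, huW⟩, rfl⟩, _, ⟨⟨k, hk, rfl⟩, hkW⟩, hku⟩ :=
        hF_side w hw ζ hζ hζw.symm _ (c₂.image_mem_nhds (inter_mem hV (ball_mem_nhds 0 hr)))
          _ (c₁.image_mem_nhds (ball_mem_nhds 0 hspos))
      exact ⟨F (Γ₂ u), ⟨u, ⟨huV, c₂.im_pos_of_mem h₂.disjoint hu huW⟩, rfl⟩, k,
        ⟨hk, c₁.im_pos_of_mem h₁.disjoint (hsr (ball_subset_closedBall hk)) hkW⟩, hku⟩)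
  have hHA : AnalyticAt ℂ H 0 := hH.analyticAt (ball_mem_nhds 0 hδ)
  have hΓ₁ : AnalyticAt ℂ Γ₁ 0 := c₁.analyticAt (mem_ball_self c₁.pos)
  have hΓ₂ : AnalyticAt ℂ Γ₂ 0 := c₂.analyticAt (mem_ball_self c₂.pos)
  have hΓ₁d := c₁.deriv_ne_zero 0 (mem_ball_self c₁.pos)
  have hΓ₂d := c₂.deriv_ne_zero 0 (mem_ball_self c₂.pos)
  -- The chain rule for `F ∘ Γ₂ = φ ∘ Γ₁ ∘ H` at `u` in the upper half-disk, solved for `F'(Γ₂ u)`,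
  -- with `u → 0`.
  refine ⟨φ' ζ * deriv Γ₁ 0 * deriv H 0 / deriv Γ₂ 0, ?_, fun hne =>
    div_ne_zero (mul_ne_zero (mul_ne_zero (hne ζ hζ) hΓ₁d) hH') hΓ₂d⟩
  refine Tendsto.mono_left ?_ (c₂.nhdsWithin_le_map h₂.disjoint)
  rw [tendsto_map'_iff]
  have hnear : ∀ᶠ u in 𝓝[{u : ℂ | 0 < u.im}] 0, u ∈ ball (0 : ℂ) δ ∩ {u | 0 < u.im} :=
    inter_mem (mem_nhdsWithin_of_mem_nhds (ball_mem_nhds 0 hδ)) self_mem_nhdsWithin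
  have hH1 : Tendsto H (𝓝[{u | 0 < u.im}] 0) (𝓝 0) :=
    (hH0 ▸ hHA.continuousAt.tendsto).mono_left nhdsWithin_le_nhds
  have hΓ₁H : ∀ u ∈ ball (0 : ℂ) δ ∩ {u | 0 < u.im}, Γ₁ (H u) ∈ W₁ := fun u hu =>
    c₁.upper _ (hsr (ball_subset_closedBall (hHU u hu.1 hu.2).1)) (hHU u hu.1 hu.2).2.1
  have t1 : Tendsto (fun u => φ' (Γ₁ (H u))) (𝓝[{u | 0 < u.im}] 0) (𝓝 (φ' ζ)) := by
    refine (hφ'.1 ζ (Or.inr hζ)).tendsto.comp (tendsto_nhdsWithin_iff.2 ⟨?_, ?_⟩)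
    · exact (c₁.map_zero ▸ hΓ₁.continuousAt.tendsto).comp hH1
    · exact hnear.mono fun u hu => Or.inl (hΓ₁H u hu)
  have t2 : Tendsto (fun u => deriv Γ₁ (H u)) (𝓝[{u | 0 < u.im}] 0) (𝓝 (deriv Γ₁ 0)) :=
    hΓ₁.deriv.continuousAt.tendsto.comp hH1
  have t3 : Tendsto (deriv H) (𝓝[{u | 0 < u.im}] 0) (𝓝 (deriv H 0)) :=
    hHA.deriv.continuousAt.tendsto.mono_left nhdsWithin_le_nhds
  have t4 : Tendsto (deriv Γ₂) (𝓝[{u | 0 < u.im}] 0) (𝓝 (deriv Γ₂ 0)) :=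
    hΓ₂.deriv.continuousAt.tendsto.mono_left nhdsWithin_le_nhds
  refine (((t1.mul t2).mul t3).div t4 hΓ₂d).congr' ?_
  filter_upwards [hnear] with u hu
  have hur : u ∈ ball (0 : ℂ) r := ball_subset_ball hδr hu.1
  have hHu : H u ∈ ball (0 : ℂ) r₁ := hsr (ball_subset_closedBall (hHU u hu.1 hu.2).1)
  have e1 : HasDerivAt (F ∘ Γ₂) (deriv F (Γ₂ u) * deriv Γ₂ u) u :=
    (hF_hol.differentiableAt (h₂.isOpen.mem_nhds (c₂.upper u hur hu.2))).hasDerivAt.comp u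
      (c₂.analyticAt hur).differentiableAt.hasDerivAt
  have e2 : HasDerivAt (φ ∘ (Γ₁ ∘ H)) (deriv φ (Γ₁ (H u)) * (deriv Γ₁ (H u) * deriv H u)) u :=
    (hφ_hol.differentiableAt (h₁.isOpen.mem_nhds (hΓ₁H u hu))).hasDerivAt.comp u
      ((c₁.analyticAt hHu).differentiableAt.hasDerivAt.comp u
        (hH.differentiableAt (isOpen_ball.mem_nhds hu.1)).hasDerivAt)
  have e3 : F ∘ Γ₂ =ᶠ[𝓝 u] φ ∘ (Γ₁ ∘ H) := by
    filter_upwards [(isOpen_upperHalfBall δ).mem_nhds hu] with v hv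
    exact (hHU v hv.1 hv.2).2.2.symm
  have e4 := e1.unique (e2.congr_of_eventuallyEq e3)
  rw [Pi.div_apply, hφ'.2 _ (hΓ₁H u hu), Function.comp_apply, div_eq_iff (c₂.deriv_ne_zero u hur), e4]
  ring

theorem theorem2p2 (W₁ J₁ W₂ J₂ : Set ℂ)
    (h₁ : IsOneSidedFreeArc W₁ J₁) (h₂ : IsOneSidedFreeArc W₂ J₂)
    (φ φ' : ℂ → ℂ)
    (hφ_inj : InjOn φ (W₁ ∪ J₁)) (hφ_cont : ContinuousOn φ (W₁ ∪ J₁))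
    (hφ_hol : DifferentiableOn ℂ φ W₁) (hφ' : IsDerivExtension φ φ' W₁ J₁)
    (F : ℂ → ℂ)
    (hF_cont : ContinuousOn F (W₂ ∪ J₂)) (hF_hol : DifferentiableOn ℂ F W₂)
    (hF_arc : F '' J₂ ⊆ φ '' J₁)
    (hF_loc : ∀ z ∈ φ '' J₁, ∃ ε > 0, ball z ε ∩ F '' W₂ ⊆ φ '' W₁)
    (hF_seq : ∀ u : ℕ → ℂ, (∀ n, u n ∈ W₂) → Bornology.IsBounded (range u) →
      AccumulatesOnlyIn u J₂ → AccumulatesOnlyIn (fun n => F (u n)) (φ '' J₁))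
    (hF_side : ApproachFromSameSide φ F W₁ J₁ W₂ J₂) :
    (∃ F' : ℂ → ℂ, IsDerivExtension F F' W₂ J₂) ∧
    ((∀ z ∈ J₁, φ' z ≠ 0) → InjOn F W₂ →
      ∀ F' : ℂ → ℂ, IsDerivExtension F F' W₂ J₂ → ∀ ζ ∈ J₂, F' ζ ≠ 0) := by
  have hlim : ∀ w ∈ J₂, ∃ y, Tendsto (deriv F) (𝓝[W₂] w) (𝓝 y) ∧
      ((∀ z ∈ J₁, φ' z ≠ 0) → y ≠ 0) := fun w hw =>
    exists_tendsto_deriv h₁ h₂ hφ_inj hφ_cont hφ_hol hφ' hF_cont hF_hol hF_arc hF_loc hF_side hw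
  have hJcl : J₂ ⊆ closure W₂ := h₂.subset_frontier.trans frontier_subset_closure
  have hdc : ContinuousOn (deriv F) W₂ := (hF_hol.deriv h₂.isOpen).continuousOn
  constructor
  -- Limits along `W₂` alone suffice: extension by limits from a dense subset is continuous because
  -- `ℂ` is regular.
  · refine ⟨extendFrom W₂ (deriv F),
      continuousOn_extendFrom (union_subset subset_closure hJcl) ?_,
      fun z hz => extendFrom_eq (subset_closure hz) (hdc z hz)⟩
    rintro z (hz | hz)
    · exact ⟨_, hdc z hz⟩
    · obtain ⟨y, hy, -⟩ := hlim z hz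
      exact ⟨y, hy⟩
  · intro hne _ F' hF' ζ hζ
    obtain ⟨y, hy, hy0⟩ := hlim ζ hζ
    have : (𝓝[W₂] ζ).NeBot := mem_closure_iff_nhdsWithin_neBot.1 (hJcl hζ)
    have h1 : Tendsto F' (𝓝[W₂] ζ) (𝓝 (F' ζ)) :=
      (hF'.1 ζ (Or.inr hζ)).mono subset_union_left
    have h2 : Tendsto F' (𝓝[W₂] ζ) (𝓝 y) :=
      hy.congr' (eventually_nhdsWithin_of_forall fun z hz => (hF'.2 z hz).symm)
    rw [tendsto_nhds_unique h1 h2]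
    exact hy0 hne
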